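/- A signed graph $\Gamma=(G,\sigma)$ consists of a finite simple graph $G$ with at least one vertex and a function $\sigma:E(G)\to\{+1,-1\}$. Its order and size are the numbers of vertices and edges of $G$, and $\Gamma$ is called bipartite if $G$ is bipartite. Its adjacency matrix has entry $\sigma(uv)$ at $(u,v)$ if $u$ and $v$ are adjacent and $0$ otherwise; let $\lambda_1(\Gamma)\ge\cdots\ge\lambda_n(\Gamma)$ be its eigenvalues, counted with multiplicity. A triangle of $\Gamma$ is balanced if it has an even number of negative edges. For $\theta:V(G)\to\{+1,-1\}$, switching $\Gamma$ by $\theta$ replaces the sign of each edge $uv$ by $\theta(u)\sigma(uv)\theta(v)$; signed graphs that arise from each other by switching, up to a relabelling of the vertices, are called switching equivalent. $(H,+)$ denotes the graph $H$ with all edges positive. **Theorem.** Let $\Gamma$ be a non-bipartite signed graph of order $n$ and size $m$ with $\lambda_1(\Gamma)\ge\sqrt{m-1}$ and $\lambda_1(\Gamma)\ge|\lambda_n(\Gamma)|$. Then $\Gamma$ contains a balanced triangle, unless $n\ge 5$ and $\Gamma$ is switching equivalent to $(C_5\cup(n-5)K_1,+)$, where $C_5\cup(n-5)K_1$ is the disjoint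 union of a cycle on five vertices and $n-5$ isolated vertices. -/

import Mathlib

/-- A signed graph on the vertex set `V`: an underlying simple graph together with a function
assigning a sign `+1` or `-1` to each of its edges. -/
structure SignedGraph (V : Type*) where
  /-- The underlying graph. -/
  graph : SimpleGraph V
  /-- The sign of each edge. -/
  sign : graph.edgeSet → ℤˣ

namespace SignedGraph

/-- The sign of the edge joining two adjacent vertices. -/
def signAdj {V : Type*} (Γ : SignedGraph V) {u v : V} (h : Γ.graph.Adj u v) : ℤˣ :=
  Γ.sign ⟨s(u, v), h⟩

theorem signAdj_symm {V : Type*} (Γ : SignedGraph V) {u v : V} (h : Γ.graph.Adj u v) :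
    Γ.signAdj h.symm = Γ.signAdj h :=
  congrArg Γ.sign (Subtype.ext Sym2.eq_swap)

/-- The signed graph `(G, +)` all of whose edges are positive. -/
def allPositive {V : Type*} (G : SimpleGraph V) : SignedGraph V where
  graph := G
  sign := fun _ => 1

/-- Switching by `θ : V → {+1, -1}`: the sign of an edge `uv` becomes `θ u * σ(uv) * θ v`. -/
def switch {V : Type*} (Γ : SignedGraph V) (θ : V → ℤˣ) : SignedGraph V where
  graph := Γ.graph
  sign := fun e => (e.1.map θ).mul * Γ.sign e

theorem signAdj_switch {V : Type*} (Γ : SignedGraph V) (θ : V → ℤˣ) {u v : V}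
    (h : Γ.graph.Adj u v) :
    (Γ.switch θ).signAdj (u := u) (v := v) h = θ u * Γ.signAdj h * θ v := by
  simp only [signAdj, switch, Sym2.map_mk, Sym2.mul_mk]
  exact mul_right_comm _ _ _

/-- Switching equivalence of two signed graphs with the same underlying graph. -/
def SwitchingEquivalent {V : Type*} (Γ₁ Γ₂ : SignedGraph V) : Prop :=
  ∃ θ : V → ℤˣ, Γ₂ = Γ₁.switch θ

/-- Two signed graphs are isomorphic if some isomorphism of their underlying graphs preserves
the signs of all edges. -/
def Isomorphic {V W : Type*} (Γ₁ : SignedGraph V) (Γ₂ : SignedGraph W) : Prop :=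
  ∃ φ : Γ₁.graph ≃g Γ₂.graph, ∀ (u v : V) (h : Γ₁.graph.Adj u v),
    Γ₂.signAdj (φ.map_adj_iff.mpr h) = Γ₁.signAdj h

/-- Switching equivalence up to a relabelling of the vertices, for signed graphs whose vertex sets
need not be the same. -/
def SwitchingEquivalentUpToIso {V W : Type*} (Γ₁ : SignedGraph V) (Γ₂ : SignedGraph W) : Prop :=
  ∃ Γ' : SignedGraph V, Γ₁.SwitchingEquivalent Γ' ∧ Γ'.Isomorphic Γ₂

/-- The set of negative edges. -/
def negEdges {V : Type*} (Γ : SignedGraph V) : Set (Sym2 V) :=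
  {e | ∃ h : e ∈ Γ.graph.edgeSet, Γ.sign ⟨e, h⟩ = -1}

open Classical in
/-- A closed walk (in particular a cycle) is balanced if it has an even number of negative
edges. -/
def IsBalancedWalk {V : Type*} (Γ : SignedGraph V) {v : V} (p : Γ.graph.Walk v v) : Prop :=
  Even (p.edges.countP (fun e => e ∈ Γ.negEdges))

/-- The signed graph contains a balanced cycle of length three. -/
def ContainsBalancedTriangle {V : Type*} (Γ : SignedGraph V) : Prop :=
  ∃ (v : V) (p : Γ.graph.Walk v v), p.IsCycle ∧ p.length = 3 ∧ Γ.IsBalancedWalk p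

open Classical in
/-- The adjacency matrix of a signed graph: the entry at `(i, j)` is the sign of the edge `ij`
if `i` and `j` are adjacent, and `0` otherwise. -/
noncomputable def adjMatrix {V : Type*} (Γ : SignedGraph V) : Matrix V V ℝ :=
  Matrix.of fun i j => if h : Γ.graph.Adj i j then ((Γ.signAdj h : ℤ) : ℝ) else 0

theorem isHermitian_adjMatrix {V : Type*} (Γ : SignedGraph V) : Γ.adjMatrix.IsHermitian := by
  refine Matrix.IsHermitian.ext fun i j => ?_
  by_cases h : Γ.graph.Adj i j
  · simp [adjMatrix, h, h.symm, Γ.signAdj_symm h]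
  · have h' : ¬ Γ.graph.Adj j i := fun k => h k.symm
    simp [adjMatrix, h, h']

/-- The eigenvalues of the adjacency matrix, with multiplicity, in non-increasing order; the index
is counted from zero, so that `Γ.eigenvalue ⟨k, _⟩` is `λ_{k+1}(Γ)`. -/
noncomputable def eigenvalue {V : Type*} [Fintype V] [DecidableEq V] (Γ : SignedGraph V)
    (k : Fin (Fintype.card V)) : ℝ :=
  Γ.isHermitian_adjMatrix.eigenvalues₀ k

/-- The largest adjacency eigenvalue `λ₁(Γ)`. -/
noncomputable def lambdaFirst {V : Type*} [Fintype V] [DecidableEq V] [Nonempty V]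
    (Γ : SignedGraph V) : ℝ :=
  Γ.eigenvalue ⟨0, Fintype.card_pos⟩

/-- The smallest adjacency eigenvalue `λₙ(Γ)`, where `n` is the order of `Γ`. -/
noncomputable def lambdaLast {V : Type*} [Fintype V] [DecidableEq V] [Nonempty V]
    (Γ : SignedGraph V) : ℝ :=
  Γ.eigenvalue ⟨Fintype.card V - 1, Nat.sub_lt Fintype.card_pos Nat.one_pos⟩

end SignedGraph

/-- The disjoint union of a cycle on five vertices and `k` isolated vertices. -/
def cycleFiveUnionIsolated (k : ℕ) : SimpleGraph (Fin 5 ⊕ Fin k) :=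
  SimpleGraph.cycleGraph 5 ⊕g (⊥ : SimpleGraph (Fin k))

/-! Switch so that the `λ₁`-eigenvector `x` is nonnegative, with maximum `M` at `u`, and suppose
there is no balanced triangle. Let `N` be the positive neighbourhood of `u`. Expanding `l ^ 2 * x u`
over walks of length two and dropping nonpositive terms gives `l ^ 2 ≤ p`, where `p` counts positive
paths `u v w`. Without positive triangles these paths correspond to distinct positive edges `vw`,
the transversal ones, each crossing the cut `N`. Non-bipartiteness forces a non-transversal edge, so
`p ≤ m - 1 ≤ l ^ 2`.

Equality therefore holds throughout: exactly one edge `ab` is not transversal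
(`not_transversal_unique`), and every discarded term vanishes (`defects_eq_zero`). The ends of
positive 2-paths from `u` then also attain `M`; `a` and `b` are among them. Repeating the argument
from `a` and `b` leaves only the five-cycle `u v a b w` (`exists_eq_map_cycleGraph`). -/

namespace SignedGraph

/-- A real symmetric matrix `B` with entries `0, 1, -1` supported on the edges of a non-bipartite
graph `G`, without all-positive triangles, with a nonnegative eigenvector `x` whose largest entry
is `M > 0` and whose eigenvalue `l ≥ 0` satisfies `l ^ 2 ≥ |E(G)| - 1`. -/
structure ExtremalPair {V : Type*} [Fintype V] (G : SimpleGraph V) (B : V → V → ℝ)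
    (x : V → ℝ) (l M : ℝ) : Prop where
  symm : ∀ i j, B i j = B j i
  values : ∀ i j, B i j = 0 ∨ B i j = 1 ∨ B i j = -1
  adj_iff : ∀ i j, G.Adj i j ↔ B i j ≠ 0
  triangle_free : ∀ i j k, B i j = 1 → B j k = 1 → B i k = 1 → False
  nonneg : ∀ i, 0 ≤ x i
  le_max : ∀ i, x i ≤ M
  max_pos : 0 < M
  eigen : ∀ i, ∑ j, B i j * x j = l * x i
  l_nonneg : 0 ≤ l
  size_le : (G.edgeSet.ncard : ℝ) - 1 ≤ l ^ 2
  not_bipartite : ¬ G.IsBipartite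

/-- An edge is transversal to `u` if it is positive and has an end joined to `u` by a positive
edge. -/
def Transversal {V : Type*} (B : V → V → ℝ) (u a b : V) : Prop :=
  B a b = 1 ∧ (B u a = 1 ∨ B u b = 1)

theorem isBipartite_of_separates {V : Type*} {G : SimpleGraph V} (S : V → Prop)
    (h : ∀ a b, G.Adj a b → (S a ↔ ¬ S b)) : G.IsBipartite := by
  classical
  refine ⟨SimpleGraph.Coloring.mk (fun v => if S v then (0 : Fin 2) else 1) ?_⟩
  intro a b hab
  have := h a b hab
  by_cases ha : S a <;> by_cases hb : S b <;> simp_all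

namespace ExtremalPair

variable {V : Type*} [Fintype V] {G : SimpleGraph V} {B : V → V → ℝ} {x : V → ℝ} {l M : ℝ}

theorem adj_of_eq_one (h : ExtremalPair G B x l M) {a b : V} (hab : B a b = 1) : G.Adj a b :=
  (h.adj_iff a b).2 (by rw [hab]; exact one_ne_zero)

theorem eq_neg_one (h : ExtremalPair G B x l M) {a b : V} (hab : G.Adj a b) (h1 : B a b ≠ 1) :
    B a b = -1 := by
  have := (h.adj_iff a b).1 hab
  have := h.values a b
  tauto

theorem transversal_comm (h : ExtremalPair G B x l M) {u a b : V} :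
    Transversal B u a b ↔ Transversal B u b a := by
  unfold Transversal
  rw [h.symm a b, or_comm]

theorem separates_of_transversal (h : ExtremalPair G B x l M) {u a b : V}
    (ht : Transversal B u a b) : B u a = 1 ↔ ¬ B u b = 1 := by
  obtain ⟨hab, hor⟩ := ht
  constructor
  · intro ha hb
    exact h.triangle_free u a b ha hab hb
  · tauto

/-- Otherwise the positive neighbourhood of `u` and its complement would be a bipartition. -/
theorem exists_not_transversal (h : ExtremalPair G B x l M) (u : V) :
    ∃ a b, G.Adj a b ∧ ¬ Transversal B u a b := by
  by_contra! hc
  exact h.not_bipartite (isBipartite_of_separates (fun v => B u v = 1)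
    fun a b hab => h.separates_of_transversal (hc a b hab))

/-! ### Counting positive 2-paths from a maximal vertex -/

open Classical in
/-- The pairs `(v, w)` such that `u v` and `v w` are positive edges. -/
noncomputable def positivePaths (B : V → V → ℝ) (u : V) : Finset (V × V) :=
  {p | B u p.1 = 1 ∧ B p.1 p.2 = 1}

theorem mem_positivePaths {u : V} {p : V × V} :
    p ∈ positivePaths B u ↔ B u p.1 = 1 ∧ B p.1 p.2 = 1 := by
  simp [positivePaths]

-- A path is determined by its second edge: if `(a, b)` and `(b, a)` both occurred, `u a b` would be
-- a positive triangle. These edges are transversal, hence disjoint from `F`.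
open Classical in
theorem card_positivePaths_add_card_le (h : ExtremalPair G B x l M) (u : V)
    (F : Finset (Sym2 V)) (hF : ∀ e ∈ F, e ∈ G.edgeSet)
    (hF' : ∀ a b, s(a, b) ∈ F → ¬ Transversal B u a b) :
    (positivePaths B u).card + F.card ≤ G.edgeSet.ncard := by
  have hinj : Set.InjOn (fun p : V × V => s(p.1, p.2)) (positivePaths B u) := by
    rintro ⟨a, b⟩ hp ⟨c, d⟩ hq hpq
    have hp := mem_positivePaths.1 (Finset.mem_coe.1 hp)
    have hq := mem_positivePaths.1 (Finset.mem_coe.1 hq)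
    rcases Sym2.eq_iff.1 hpq with ⟨h1, h2⟩ | ⟨h1, h2⟩
    · exact Prod.ext h1 h2
    · simp only at h1 h2 hp hq
      subst h1 h2
      exact (h.triangle_free u _ _ hp.1 hp.2 hq.1).elim
  rw [← Finset.card_image_of_injOn hinj, ← Finset.card_union_of_disjoint,
    ← Set.ncard_coe_finset]
  · refine Set.ncard_le_ncard ?_ (Set.toFinite _)
    intro e he
    rcases Finset.mem_union.1 (Finset.mem_coe.1 he) with he | he
    · obtain ⟨p, hp, rfl⟩ := Finset.mem_image.1 he
      exact h.adj_of_eq_one (mem_positivePaths.1 hp).2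
    · exact hF e he
  · rw [Finset.disjoint_left]
    intro e he he'
    obtain ⟨p, hp, rfl⟩ := Finset.mem_image.1 he
    have hp := mem_positivePaths.1 hp
    exact hF' _ _ he' ⟨hp.2, Or.inl hp.1⟩

-- The gap between the path count and `l ^ 2` is split into local defects: one per pair `(v, w)`,
-- one per `v` not positively joined to `u`. Each is nonnegative, so equality in the count kills
-- each separately.
open Classical in
theorem sq_mul_max_eq (h : ExtremalPair G B x l M) {u : V} (hu : x u = M) :
    (positivePaths B u).card * M - l ^ 2 * M =
      (∑ p : V × V, ((if B u p.1 = 1 ∧ B p.1 p.2 = 1 then M else 0)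
        - if B u p.1 = 1 then B p.1 p.2 * x p.2 else 0))
      + ∑ v, if B u v = 1 then 0 else -(B u v * (l * x v)) := by
  have h1 : l ^ 2 * M = ∑ v, B u v * (l * x v) := by
    rw [sq, mul_assoc, ← hu, ← h.eigen u, Finset.mul_sum]
    exact Finset.sum_congr rfl fun v _ => by ring
  have h2 : ((positivePaths B u).card : ℝ) * M =
      ∑ p : V × V, if B u p.1 = 1 ∧ B p.1 p.2 = 1 then M else 0 := by
    rw [← Finset.sum_filter, Finset.sum_const, nsmul_eq_mul]
    congr!
  rw [Finset.sum_sub_distrib, ← h2, h1,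
    Fintype.sum_prod_type (f := fun p : V × V => if B u p.1 = 1 then B p.1 p.2 * x p.2 else 0),
    sub_add, ← Finset.sum_sub_distrib]
  congr 1
  refine Finset.sum_congr rfl fun v _ => ?_
  by_cases hv : B u v = 1
  · simp [hv, h.eigen v]
  · simp [hv]

theorem pair_defect_nonneg (h : ExtremalPair G B x l M) (v w : V) :
    B v w * x w ≤ if B v w = 1 then M else 0 := by
  have h1 := h.nonneg w
  have h2 := h.le_max w
  rcases h.values v w with hv | hv | hv <;> norm_num [hv] <;> linarith

theorem neighbour_defect_nonneg (h : ExtremalPair G B x l M) (u v : V) (huv : B u v ≠ 1) :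
    0 ≤ -(B u v * (l * x v)) := by
  have h1 := mul_nonneg h.l_nonneg (h.nonneg v)
  rcases h.values u v with hv | hv | hv
  · simp [hv]
  · exact (huv hv).elim
  · simpa [hv] using h1

theorem sq_mul_max_le (h : ExtremalPair G B x l M) {u : V} (hu : x u = M) :
    l ^ 2 ≤ (positivePaths B u).card := by
  classical
  have key := h.sq_mul_max_eq hu
  have h1 : 0 ≤ (∑ p : V × V, ((if B u p.1 = 1 ∧ B p.1 p.2 = 1 then M else 0)
        - if B u p.1 = 1 then B p.1 p.2 * x p.2 else 0)) := by
    refine Finset.sum_nonneg fun p _ => ?_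
    have := h.pair_defect_nonneg p.1 p.2
    by_cases hp : B u p.1 = 1 <;> simp [hp]
    simpa using this
  have h2 : 0 ≤ ∑ v, if B u v = 1 then 0 else -(B u v * (l * x v)) := by
    refine Finset.sum_nonneg fun v _ => ?_
    split_ifs with hv
    · exact le_rfl
    · exact h.neighbour_defect_nonneg u v hv
  refine le_of_mul_le_mul_right ?_ h.max_pos
  linarith

/-- Two such edges would give `l ^ 2 ≤ p ≤ m - 2`, with `p` the number of positive paths. -/
theorem not_transversal_unique (h : ExtremalPair G B x l M) {u : V} (hu : x u = M)
    {a b c d : V} (hab : G.Adj a b) (hab' : ¬ Transversal B u a b)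
    (hcd : G.Adj c d) (hcd' : ¬ Transversal B u c d) : s(a, b) = s(c, d) := by
  classical
  by_contra hne
  have hcard := h.card_positivePaths_add_card_le u {s(a, b), s(c, d)}
    (by simp [hab, hcd]) (by
      intro p q hpq
      simp only [Finset.mem_insert, Finset.mem_singleton, Sym2.eq_iff] at hpq
      rcases hpq with (⟨rfl, rfl⟩ | ⟨rfl, rfl⟩) | (⟨rfl, rfl⟩ | ⟨rfl, rfl⟩)
      · exact hab'
      · rwa [h.transversal_comm]
      · exact hcd'
      · rwa [h.transversal_comm])
  rw [Finset.card_pair hne] at hcard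
  have h1 := h.sq_mul_max_le hu
  have h2 := h.size_le
  have h3 : ((positivePaths B u).card : ℝ) + 2 ≤ G.edgeSet.ncard := by exact_mod_cast hcard
  linarith

/-- One non-transversal edge already gives `p ≤ m - 1 ≤ l ^ 2`, so the nonnegative defects have sum
at most zero. -/
theorem defects_eq_zero (h : ExtremalPair G B x l M) {u : V} (hu : x u = M) :
    (∀ v w, B u v = 1 → B v w * x w = if B v w = 1 then M else 0) ∧
      ∀ v, B u v ≠ 1 → B u v * (l * x v) = 0 := by
  classical
  obtain ⟨a, b, hab, hab'⟩ := h.exists_not_transversal u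
  have hcard := h.card_positivePaths_add_card_le u {s(a, b)} (by simp [hab]) (by
      intro p q hpq
      simp only [Finset.mem_singleton, Sym2.eq_iff] at hpq
      rcases hpq with ⟨rfl, rfl⟩ | ⟨rfl, rfl⟩
      · exact hab'
      · rwa [h.transversal_comm])
  rw [Finset.card_singleton] at hcard
  have h3 : ((positivePaths B u).card : ℝ) + 1 ≤ G.edgeSet.ncard := by exact_mod_cast hcard
  have h4 : ((positivePaths B u).card : ℝ) * M ≤ l ^ 2 * M :=
    mul_le_mul_of_nonneg_right (by linarith [h.size_le]) h.max_pos.le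
  have key := h.sq_mul_max_eq hu
  have n1 : ∀ p : V × V, 0 ≤ (if B u p.1 = 1 ∧ B p.1 p.2 = 1 then M else 0)
        - if B u p.1 = 1 then B p.1 p.2 * x p.2 else 0 := by
    intro p
    have := h.pair_defect_nonneg p.1 p.2
    by_cases hp : B u p.1 = 1 <;> simp [hp]
    simpa using this
  have n2 : ∀ v, 0 ≤ if B u v = 1 then 0 else -(B u v * (l * x v)) := by
    intro v
    split_ifs with hv
    · exact le_rfl
    · exact h.neighbour_defect_nonneg u v hv
  have s1 := Finset.sum_nonneg fun p (_ : p ∈ Finset.univ) => n1 p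
  have s2 := Finset.sum_nonneg fun v (_ : v ∈ Finset.univ) => n2 v
  have z1 := (Finset.sum_eq_zero_iff_of_nonneg fun p (_ : p ∈ Finset.univ) => n1 p).1
    (by linarith)
  have z2 := (Finset.sum_eq_zero_iff_of_nonneg fun v (_ : v ∈ Finset.univ) => n2 v).1
    (by linarith)
  constructor
  · intro v w hv
    have := z1 (v, w) (Finset.mem_univ _)
    simp only [hv, true_and, if_true] at this
    linarith
  · intro v hv
    have := z2 v (Finset.mem_univ _)
    simp only [hv, if_false] at this
    linarith

/-! ### Consequences of equality for the non-transversal edge -/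

theorem eq_max_of_path (h : ExtremalPair G B x l M) {u v w : V} (hu : x u = M)
    (huv : B u v = 1) (hvw : B v w = 1) : x w = M := by
  simpa [hvw] using (h.defects_eq_zero hu).1 v w huv

theorem eq_zero_of_negative_path (h : ExtremalPair G B x l M) {u v w : V} (hu : x u = M)
    (huv : B u v = 1) (hvw : B v w = -1) : x w = 0 := by
  have := (h.defects_eq_zero hu).1 v w huv
  norm_num [hvw] at this
  exact this

theorem mul_eq_zero_of_negative_edge (h : ExtremalPair G B x l M) {u v : V} (hu : x u = M)
    (huv : B u v = -1) : l * x v = 0 := by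
  have := (h.defects_eq_zero hu).2 v (by norm_num [huv])
  rw [huv] at this
  linarith

/-- The unique non-transversal edge does not cross the cut given by the positive neighbourhood. -/
theorem not_separates_of_not_transversal (h : ExtremalPair G B x l M) {u : V} (hu : x u = M)
    {a b : V} (hab : G.Adj a b) (hab' : ¬ Transversal B u a b) : B u a = 1 ↔ B u b = 1 := by
  by_contra hc
  refine h.not_bipartite (isBipartite_of_separates (fun v => B u v = 1) fun c d hcd => ?_)
  by_cases ht : Transversal B u c d
  · exact h.separates_of_transversal ht
  · rcases Sym2.eq_iff.1 (h.not_transversal_unique hu hab hab' hcd ht) with ⟨rfl, rfl⟩ | ⟨rfl, rfl⟩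
    <;> tauto

/-- The ends of the unique non-transversal edge lie outside the positive neighbourhood. -/
theorem ne_one_of_not_transversal (h : ExtremalPair G B x l M) {u : V} (hu : x u = M)
    {a b : V} (hab : G.Adj a b) (hab' : ¬ Transversal B u a b) : B u a ≠ 1 := by
  intro ha
  have hb := (h.not_separates_of_not_transversal hu hab hab').1 ha
  have hneg : B a b = -1 := h.eq_neg_one hab fun h1 => hab' ⟨h1, Or.inl ha⟩
  have hneg' : B b a = -1 := by rw [h.symm]; exact hneg
  have hxb := h.eq_zero_of_negative_path hu ha hneg
  have hsum := h.eigen b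
  rw [hxb, mul_zero] at hsum
  -- Row `b` of the eigenvalue equation sums to zero; vanishing defects make its terms nonnegative,
  -- yet the term at `u` is `M > 0`.
  have hnn : ∀ w ∈ Finset.univ, 0 ≤ B b w * x w := by
    intro w _
    rw [(h.defects_eq_zero hu).1 b w hb]
    split_ifs
    · exact h.max_pos.le
    · exact le_rfl
  have := (Finset.sum_eq_zero_iff_of_nonneg hnn).1 hsum u (Finset.mem_univ _)
  rw [h.symm b u, hb, hu, one_mul] at this
  exact h.max_pos.ne' this

/-- Each end of the unique non-transversal edge is reached by a positive path from `u`. -/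
theorem exists_path_of_not_transversal (h : ExtremalPair G B x l M) {u : V} (hu : x u = M)
    {a b : V} (hab : G.Adj a b) (hab' : ¬ Transversal B u a b) :
    ∃ v, B u v = 1 ∧ B v a = 1 := by
  by_contra! hc
  have ha := h.ne_one_of_not_transversal hu hab hab'
  have hb := h.ne_one_of_not_transversal hu hab.symm (by rwa [← h.transversal_comm])
  have hne := hab.ne
  -- No transversal edge meets `a`, so moving `a` across the cut makes `ab` cross it and spoils no
  -- other edge.
  refine h.not_bipartite (isBipartite_of_separates (fun v => B u v = 1 ∨ v = a) fun c d hcd => ?_)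
  by_cases ht : Transversal B u c d
  · have hs := h.separates_of_transversal ht
    have hcd1 := ht.1
    have hca : c ≠ a := by
      rintro rfl
      exact hc d (by tauto) (by rw [h.symm]; exact hcd1)
    have hda : d ≠ a := by
      rintro rfl
      exact hc c (by tauto) hcd1
    tauto
  · rcases Sym2.eq_iff.1 (h.not_transversal_unique hu hab hab' hcd ht) with ⟨rfl, rfl⟩ | ⟨rfl, rfl⟩
    · simp [hb, hne.symm]
    · simp [hb, hne.symm]

/-- Both ends attain `M`, so a negative edge `ab` would force `l = 0` and at most one edge; but the
positive edge `va` is a second one. -/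
theorem eq_one_of_not_transversal (h : ExtremalPair G B x l M) {u : V} (hu : x u = M)
    {a b : V} (hab : G.Adj a b) (hab' : ¬ Transversal B u a b) : B a b = 1 := by
  by_contra h1
  have hneg := h.eq_neg_one hab h1
  obtain ⟨v, huv, hva⟩ := h.exists_path_of_not_transversal hu hab hab'
  obtain ⟨w, huw, hwb⟩ := h.exists_path_of_not_transversal hu hab.symm
    (by rwa [← h.transversal_comm])
  have hxa := h.eq_max_of_path hu huv hva
  have hxb := h.eq_max_of_path hu huw hwb
  have hl := h.mul_eq_zero_of_negative_edge hxa hneg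
  rw [hxb] at hl
  have hl0 : l = 0 := (mul_eq_zero.1 hl).resolve_right h.max_pos.ne'
  have hsz := h.size_le
  have hle : G.edgeSet.ncard ≤ 1 := by
    have : (G.edgeSet.ncard : ℝ) ≤ 1 := by rw [hl0] at hsz; linarith
    exact_mod_cast this
  have heq := (Set.ncard_le_one (Set.toFinite _)).1 hle s(a, b) hab s(v, a)
    (h.adj_of_eq_one hva)
  rcases Sym2.eq_iff.1 heq with ⟨_, rfl⟩ | ⟨_, rfl⟩
  · exact hab.ne rfl
  · rw [hneg.symm.trans (h.symm _ _)] at hneg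
    exact h1 (by rw [h.symm]; exact hva)

/-- Seen from `b`, which is also maximal, both `uc` and `uv` are non-transversal, so uniqueness
identifies them. -/
theorem eq_of_path_of_not_transversal (h : ExtremalPair G B x l M) {u : V} (hu : x u = M)
    {a b v c : V} (hab : G.Adj a b) (hab' : ¬ Transversal B u a b)
    (huv : B u v = 1) (hva : B v a = 1) (huc : B u c = 1) (hca : B c a = 1) : c = v := by
  have hab1 := h.eq_one_of_not_transversal hu hab hab'
  have hba' : ¬ Transversal B u b a := by rwa [← h.transversal_comm]
  obtain ⟨w, huw, hwb⟩ := h.exists_path_of_not_transversal hu hab.symm hba'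
  have hxb := h.eq_max_of_path hu huw hwb
  have hub := h.ne_one_of_not_transversal hu hab.symm hba'
  have key : ∀ d, B u d = 1 → B d a = 1 → ¬ Transversal B b u d := by
    rintro d hud hda ⟨-, h1 | h1⟩
    · exact hub (by rw [h.symm]; exact h1)
    · exact h.triangle_free d a b hda hab1 (by rw [h.symm]; exact h1)
  have := h.not_transversal_unique hxb (h.adj_of_eq_one huc) (key c huc hca)
    (h.adj_of_eq_one huv) (key v huv hva)
  exact Sym2.congr_right.1 this

/-! ### Identification of the five-cycle -/

/-- The graph of an extremal pair is a five-cycle up to isolated vertices, and all edges are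
positive. -/
theorem exists_eq_map_cycleGraph (h : ExtremalPair G B x l M) {u : V} (hu : x u = M) :
    (∀ a b, G.Adj a b → B a b = 1) ∧
      ∃ f : Fin 5 ↪ V, G = (SimpleGraph.cycleGraph 5).map f := by
  have hpos : ∀ a b, G.Adj a b → B a b = 1 := by
    intro a b hab
    by_cases ht : Transversal B u a b
    · exact ht.1
    · exact h.eq_one_of_not_transversal hu hab ht
  refine ⟨hpos, ?_⟩
  obtain ⟨a, b, hab, hab'⟩ := h.exists_not_transversal u
  have hba' : ¬ Transversal B u b a := by rwa [← h.transversal_comm]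
  obtain ⟨v, huv, hva⟩ := h.exists_path_of_not_transversal hu hab hab'
  obtain ⟨w, huw, hwb⟩ := h.exists_path_of_not_transversal hu hab.symm hba'
  have hab1 := hpos a b hab
  have hua := h.ne_one_of_not_transversal hu hab hab'
  have hub := h.ne_one_of_not_transversal hu hab.symm hba'
  have hxa := h.eq_max_of_path hu huv hva
  have hxb := h.eq_max_of_path hu huw hwb
  have outer : ∀ p q, B p q = 1 → B u p ≠ 1 → B u q ≠ 1 → s(p, q) = s(a, b) := fun p q h1 h2 h3 =>
    h.not_transversal_unique hu (h.adj_of_eq_one h1) (fun ht => ht.2.elim h2 h3) hab hab'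
  -- The exceptional edge is `uw` seen from `a`, and `uv` seen from `b`.
  have huw' : ¬ Transversal B a u w := by
    rintro ⟨-, h1 | h1⟩
    · exact hua (by rw [h.symm]; exact h1)
    · exact h.triangle_free a b w hab1 (by rw [h.symm]; exact hwb) h1
  have huv' : ¬ Transversal B b u v := by
    rintro ⟨-, h1 | h1⟩
    · exact hub (by rw [h.symm]; exact h1)
    · exact h.triangle_free v a b hva hab1 (by rw [h.symm]; exact h1)
  have main : ∀ c d, B u c = 1 → B c d = 1 →
      s(c, d) = s(v, u) ∨ s(c, d) = s(v, a) ∨ s(c, d) = s(w, b) ∨ s(c, d) = s(w, u) := by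
    intro c d huc hcd
    have hud : B u d ≠ 1 := fun hud => h.triangle_free u c d huc hcd hud
    have h1 : B a d = 1 → d = b := fun hd => Sym2.congr_right.1 (outer a d hd hua hud)
    have h2 : B b d = 1 → d = a := fun hd =>
      Sym2.congr_right.1 ((outer b d hd hub hud).trans Sym2.eq_swap)
    have ca : B c a = 1 → c = v := h.eq_of_path_of_not_transversal hu hab hab' huv hva huc
    have cb : B c b = 1 → c = w := h.eq_of_path_of_not_transversal hu hab.symm hba' huw hwb huc
    -- An edge not transversal to `a` is `uw`. Otherwise `c` or `d` is a neighbour of `a`, which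
    -- forces `c = v` or `d = b`; in the former case the view from `b` decides.
    by_cases ta : Transversal B a c d
    · rcases ta.2 with hac | had
      · obtain rfl := ca (by rw [h.symm]; exact hac)
        by_cases tb : Transversal B b c d
        · rcases tb.2 with hbc | hbd
          · exact (h.triangle_free c a b hva hab1 (by rw [h.symm]; exact hbc)).elim
          · exact Or.inr (Or.inl (by rw [h2 hbd]))
        · exact Or.inl ((h.not_transversal_unique hxb (h.adj_of_eq_one hcd) tb
            (h.adj_of_eq_one huv) huv').trans Sym2.eq_swap)
      · obtain rfl := h1 had
        exact Or.inr (Or.inr (Or.inl (by rw [cb hcd])))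
    · exact Or.inr (Or.inr (Or.inr ((h.not_transversal_unique hxa (h.adj_of_eq_one hcd) ta
        (h.adj_of_eq_one huw) huw').trans Sym2.eq_swap)))
  have edges : ∀ c d, G.Adj c d → s(c, d) = s(a, b) ∨
      s(c, d) = s(v, u) ∨ s(c, d) = s(v, a) ∨ s(c, d) = s(w, b) ∨ s(c, d) = s(w, u) := by
    intro c d hcd
    have hcd1 := hpos c d hcd
    by_cases hc : B u c = 1
    · exact Or.inr (main c d hc hcd1)
    · by_cases hd : B u d = 1
      · rw [Sym2.eq_swap (a := c)]
        exact Or.inr (main d c hd (by rw [h.symm]; exact hcd1))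
      · exact Or.inl (outer c d hcd1 hc hd)
  have nuv := (h.adj_of_eq_one huv).ne
  have nuw := (h.adj_of_eq_one huw).ne
  have nva := (h.adj_of_eq_one hva).ne
  have nwb := (h.adj_of_eq_one hwb).ne
  have nab := hab.ne
  have nvw : v ≠ w := by
    rintro rfl
    exact h.triangle_free v a b hva hab1 hwb
  have nvb : v ≠ b := by rintro rfl; exact hub huv
  have nwa : w ≠ a := by rintro rfl; exact hua huw
  have nua : u ≠ a := by rintro rfl; exact hub hab1
  have nub : u ≠ b := by rintro rfl; exact hua (by rw [h.symm]; exact hab1)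
  have hinj : Function.Injective ![u, v, a, b, w] := by
    intro i j hij
    fin_cases i <;> fin_cases j <;> simp_all
  refine ⟨⟨_, hinj⟩, ?_⟩
  ext c d
  rw [SimpleGraph.map_adj]
  constructor
  · intro hcd
    have adj : ∀ i j : Fin 5, (SimpleGraph.cycleGraph 5).Adj i j →
        s(c, d) = s(![u, v, a, b, w] i, ![u, v, a, b, w] j) →
        ∃ i' j', (SimpleGraph.cycleGraph 5).Adj i' j' ∧
          ![u, v, a, b, w] i' = c ∧ ![u, v, a, b, w] j' = d := by
      intro i j hij he
      rcases Sym2.eq_iff.1 he with ⟨h1, h2⟩ | ⟨h1, h2⟩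
      · exact ⟨i, j, hij, h1.symm, h2.symm⟩
      · exact ⟨j, i, hij.symm, h1.symm, h2.symm⟩
    rcases edges c d hcd with he | he | he | he | he
    · exact adj 2 3 (by decide) he
    · exact adj 1 0 (by decide) he
    · exact adj 1 2 (by decide) he
    · exact adj 4 3 (by decide) he
    · exact adj 4 0 (by decide) he
  · rintro ⟨i, j, hij, rfl, rfl⟩
    have g1 := h.adj_of_eq_one huv
    have g2 := h.adj_of_eq_one huw
    have g3 := h.adj_of_eq_one hva
    have g4 := h.adj_of_eq_one hwb
    have hij' : i - j = 1 ∨ j - i = 1 := SimpleGraph.cycleGraph_adj.1 hij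
    fin_cases i <;> fin_cases j <;> first
      | exact g1 | exact g2 | exact g3 | exact g4 | exact hab
      | exact g1.symm | exact g2.symm | exact g3.symm | exact g4.symm | exact hab.symm
      | exact absurd hij' (by decide)

end ExtremalPair

/-! ### Isolated vertices, balanced triangles and switching -/

theorem nonempty_iso_sum_bot_of_eq_map {V W : Type*} [Fintype V] [Fintype W]
    {G : SimpleGraph V} {H : SimpleGraph W} (f : W ↪ V) (hG : G = H.map f) {k : ℕ}
    (hk : Fintype.card V = Fintype.card W + k) :
    Nonempty (G ≃g (H ⊕g (⊥ : SimpleGraph (Fin k)))) := by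
  classical
  have hc : Fintype.card {v // ¬ v ∈ Set.range f} = k := by
    have h1 := Fintype.card_subtype_compl (fun v => v ∈ Set.range f)
    have h2 : Fintype.card {v // v ∈ Set.range f} = Fintype.card W :=
      (Fintype.card_congr (Equiv.ofInjective f f.injective)).symm
    omega
  let e : W ⊕ Fin k ≃ V :=
    (Equiv.sumCongr (Equiv.ofInjective f f.injective) (Fintype.equivFinOfCardEq hc).symm).trans
      (Equiv.sumCompl (fun v => v ∈ Set.range f))
  have hl : ∀ w, e (Sum.inl w) = f w := fun w => rfl
  have hr : ∀ i, e (Sum.inr i) ∉ Set.range f := fun i =>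
    ((Fintype.equivFinOfCardEq hc).symm i).2
  refine ⟨RelIso.symm ⟨e, ?_⟩⟩
  intro p q
  subst hG
  rw [SimpleGraph.map_adj]
  constructor
  · rintro ⟨i, j, hij, hi, hj⟩
    rw [← hl, e.injective.eq_iff] at hi hj
    subst hi hj
    simpa using hij
  · rcases p with p | p <;> rcases q with q | q
    · intro hpq
      exact ⟨p, q, by simpa using hpq, rfl, rfl⟩
    all_goals intro hpq; simp at hpq

theorem containsBalancedTriangle_of_mul_eq_one {V : Type*} (Γ : SignedGraph V) {a b c : V}
    (hab : Γ.graph.Adj a b) (hbc : Γ.graph.Adj b c) (hca : Γ.graph.Adj c a)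
    (h : Γ.signAdj hab * Γ.signAdj hbc * Γ.signAdj hca = 1) : Γ.ContainsBalancedTriangle := by
  classical
  refine ⟨a, .cons hab (.cons hbc (.cons hca .nil)), ?_, rfl, ?_⟩
  · rw [SimpleGraph.Walk.cons_isCycle_iff]
    simp [hab.ne, hab.ne.symm, hbc.ne, hca.ne, hca.ne.symm]
  · have mem : ∀ {p q : V} (hpq : Γ.graph.Adj p q),
        s(p, q) ∈ Γ.negEdges ↔ Γ.signAdj hpq = -1 := fun hpq =>
      ⟨fun ⟨_, h⟩ => h, fun h => ⟨hpq, h⟩⟩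
    have ne : (1 : ℤˣ) ≠ -1 := by decide
    simp only [IsBalancedWalk, SimpleGraph.Walk.edges_cons, SimpleGraph.Walk.edges_nil,
      List.countP_cons, List.countP_nil, mem hab, mem hbc, mem hca, decide_eq_true_eq]
    rcases Int.units_eq_one_or (Γ.signAdj hab) with h1 | h1 <;>
    rcases Int.units_eq_one_or (Γ.signAdj hbc) with h2 | h2 <;>
    rcases Int.units_eq_one_or (Γ.signAdj hca) with h3 | h3 <;>
    simp [h1, h2, h3, ne] at h ⊢

theorem adjMatrix_of_adj {V : Type*} (Γ : SignedGraph V) {a b : V} (h : Γ.graph.Adj a b) :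
    Γ.adjMatrix a b = ((Γ.signAdj h : ℤ) : ℝ) := by
  simp [adjMatrix, h]

theorem adjMatrix_of_not_adj {V : Type*} (Γ : SignedGraph V) {a b : V} (h : ¬ Γ.graph.Adj a b) :
    Γ.adjMatrix a b = 0 := by
  simp [adjMatrix, h]

theorem adjMatrix_switch {V : Type*} (Γ : SignedGraph V) (θ : V → ℤˣ) (a b : V) :
    (Γ.switch θ).adjMatrix a b = ((θ a : ℤ) : ℝ) * Γ.adjMatrix a b * ((θ b : ℤ) : ℝ) := by
  by_cases h : Γ.graph.Adj a b
  · rw [adjMatrix_of_adj (Γ.switch θ) h, adjMatrix_of_adj Γ h, signAdj_switch]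
    push_cast
    rfl
  · rw [adjMatrix_of_not_adj (Γ.switch θ) h, adjMatrix_of_not_adj Γ h]
    simp

theorem adjMatrix_eq_one_iff {V : Type*} (Γ : SignedGraph V) {a b : V} :
    Γ.adjMatrix a b = 1 ↔ ∃ h : Γ.graph.Adj a b, Γ.signAdj h = 1 := by
  by_cases h : Γ.graph.Adj a b
  · rw [adjMatrix_of_adj Γ h]
    rcases Int.units_eq_one_or (Γ.signAdj h) with h1 | h1 <;> norm_num [h1, h]
  · simp [adjMatrix_of_not_adj Γ h, h]

/-- Each `θ` value occurs twice around a triangle, so switching preserves the product of its signs.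
-/
theorem containsBalancedTriangle_of_adjMatrix_switch {V : Type*} (Γ : SignedGraph V)
    (θ : V → ℤˣ) {a b c : V} (hab : (Γ.switch θ).adjMatrix a b = 1)
    (hbc : (Γ.switch θ).adjMatrix b c = 1) (hac : (Γ.switch θ).adjMatrix a c = 1) :
    Γ.ContainsBalancedTriangle := by
  obtain ⟨gab, sab⟩ := (adjMatrix_eq_one_iff _).1 hab
  obtain ⟨gbc, sbc⟩ := (adjMatrix_eq_one_iff _).1 hbc
  obtain ⟨gac, sac⟩ := (adjMatrix_eq_one_iff _).1 hac
  refine Γ.containsBalancedTriangle_of_mul_eq_one gab gbc gac.symm ?_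
  replace sab := (Γ.signAdj_switch θ gab).symm.trans sab
  replace sbc := (Γ.signAdj_switch θ gbc).symm.trans sbc
  replace sac := (Γ.signAdj_switch θ gac).symm.trans sac
  rw [Γ.signAdj_symm gac]
  rcases Int.units_eq_one_or (θ a) with ha | ha <;>
  rcases Int.units_eq_one_or (θ b) with hb | hb <;>
  rcases Int.units_eq_one_or (θ c) with hc | hc <;>
  simp_all [neg_eq_iff_eq_neg]

theorem exists_eigenvector_lambdaFirst {V : Type*} [Fintype V] [DecidableEq V] [Nonempty V]
    (Γ : SignedGraph V) :
    ∃ y : V → ℝ, y ≠ 0 ∧ ∀ i, ∑ j, Γ.adjMatrix i j * y j = Γ.lambdaFirst * y i := by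
  let e : Fin (Fintype.card V) ≃ V := Fintype.equivOfCardEq (Fintype.card_fin _)
  let i₀ : V := e ⟨0, Fintype.card_pos⟩
  have hi₀ : Γ.isHermitian_adjMatrix.eigenvalues i₀ = Γ.lambdaFirst := by
    simp [Matrix.IsHermitian.eigenvalues, lambdaFirst, eigenvalue, i₀, e]
  refine ⟨Γ.isHermitian_adjMatrix.eigenvectorBasis i₀, ?_, fun i => ?_⟩
  · intro h0
    have := Γ.isHermitian_adjMatrix.eigenvectorBasis.toBasis.ne_zero i₀
    apply this
    ext j
    simpa using congrFun h0 j
  · have := congrFun (Γ.isHermitian_adjMatrix.mulVec_eigenvectorBasis i₀) i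
    rw [hi₀] at this
    simpa [Matrix.mulVec, dotProduct] using this

/-- Switching by the signs of an eigenvector makes it nonnegative. -/
theorem exists_switch_nonneg_eigenvector {V : Type*} [Fintype V] (Γ : SignedGraph V)
    {y : V → ℝ} {l : ℝ} (hy : ∀ i, ∑ j, Γ.adjMatrix i j * y j = l * y i) :
    ∃ θ : V → ℤˣ, ∀ i, ∑ j, (Γ.switch θ).adjMatrix i j * |y j| = l * |y i| := by
  classical
  -- The sign chosen at a zero entry is immaterial.
  let θ : V → ℤˣ := fun i => if 0 ≤ y i then 1 else -1
  have h1 : ∀ i, |y i| = ((θ i : ℤ) : ℝ) * y i := by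
    intro i
    by_cases h : 0 ≤ y i
    · simp [θ, h, abs_of_nonneg h]
    · simp [θ, h, abs_of_neg (not_le.1 h)]
  have h2 : ∀ i, ((θ i : ℤ) : ℝ) * ((θ i : ℤ) : ℝ) = 1 := by
    intro i
    rcases Int.units_eq_one_or (θ i) with h | h <;> simp [h]
  refine ⟨θ, fun i => ?_⟩
  calc ∑ j, (Γ.switch θ).adjMatrix i j * |y j|
      = ∑ j, ((θ i : ℤ) : ℝ) * (Γ.adjMatrix i j * y j) := by
        refine Finset.sum_congr rfl fun j _ => ?_
        rw [adjMatrix_switch, h1 j]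
        linear_combination ((θ i : ℤ) : ℝ) * Γ.adjMatrix i j * y j * h2 j
    _ = l * |y i| := by
        rw [← Finset.mul_sum, hy, h1 i]
        ring

end SignedGraph

open SignedGraph in
theorem theorem1p2 {V : Type*} [Fintype V] [DecidableEq V] [Nonempty V]
    (Γ : SignedGraph V) (n m : ℕ)
    (hn : Fintype.card V = n) (hm : Γ.graph.edgeSet.ncard = m)
    (hbip : ¬ Γ.graph.IsBipartite)
    (h₁ : Real.sqrt ((m : ℝ) - 1) ≤ Γ.lambdaFirst)
    (h₂ : |Γ.lambdaLast| ≤ Γ.lambdaFirst) :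
    Γ.ContainsBalancedTriangle ∨
      Γ.SwitchingEquivalentUpToIso
        (SignedGraph.allPositive (cycleFiveUnionIsolated (n - 5))) := by
  by_cases hT : Γ.ContainsBalancedTriangle
  · exact Or.inl hT
  refine Or.inr ?_
  obtain ⟨y, hy0, hy⟩ := Γ.exists_eigenvector_lambdaFirst
  obtain ⟨θ, hθ⟩ := Γ.exists_switch_nonneg_eigenvector hy
  obtain ⟨u, hu⟩ := Finite.exists_max fun i => |y i|
  obtain ⟨i, hi⟩ := Function.ne_iff.1 hy0
  have hE : ExtremalPair Γ.graph (Γ.switch θ).adjMatrix (fun i => |y i|) Γ.lambdaFirst |y u| :=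
    { symm := fun i j => by
        simpa using (Γ.switch θ).isHermitian_adjMatrix.apply j i
      values := fun i j => by
        by_cases h : (Γ.switch θ).graph.Adj i j
        · rw [adjMatrix_of_adj _ h]
          rcases Int.units_eq_one_or ((Γ.switch θ).signAdj h) with h1 | h1 <;> simp [h1]
        · exact Or.inl (adjMatrix_of_not_adj _ h)
      adj_iff := fun i j => by
        refine ⟨fun h => ?_, fun h => ?_⟩
        · rw [adjMatrix_of_adj (Γ.switch θ) h]
          simp
        · by_contra h'
          exact h (adjMatrix_of_not_adj (Γ.switch θ) h')
      triangle_free := fun i j k h1 h2 h3 =>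
        hT (Γ.containsBalancedTriangle_of_adjMatrix_switch θ h1 h2 h3)
      nonneg := fun i => abs_nonneg _
      le_max := hu
      max_pos := (abs_pos.2 hi).trans_le (hu i)
      eigen := hθ
      l_nonneg := (Real.sqrt_nonneg _).trans h₁
      size_le := by
        rw [hm]
        exact (Real.sqrt_le_left ((Real.sqrt_nonneg _).trans h₁)).1 h₁
      not_bipartite := hbip }
  obtain ⟨hpos, f, hf⟩ := hE.exists_eq_map_cycleGraph (u := u) rfl
  -- This makes the truncated difference `n - 5` the true number of isolated vertices.
  have h5 : 5 ≤ Fintype.card V := by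
    simpa using Fintype.card_le_of_embedding f
  obtain ⟨φ⟩ := nonempty_iso_sum_bot_of_eq_map f hf (k := n - 5) (by simp; omega)
  refine ⟨Γ.switch θ, ⟨θ, rfl⟩, φ, fun a b hab => ?_⟩
  obtain ⟨_, hs⟩ := (adjMatrix_eq_one_iff _).1 (hpos a b hab)
  exact hs.symm
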